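/- Let $K$ be a field of arbitrary characteristic and $n \ge 0$, and let $\mathrm{Sp}(2n,K)$ be the group of all $2n\times 2n$ matrices $P$ over $K$ with $PGP^{T}=G$, where $G=\begin{pmatrix}0&I_n\\-I_n&0\end{pmatrix}$. A matrix $P\in \mathrm{Sp}(2n,K)$ is conjugate in $\mathrm{Sp}(2n,K)$ to a block matrix $\begin{pmatrix}0&B\\-B^{-1}&D\end{pmatrix}\in \mathrm{Sp}(2n,K)$ with $B, D\in K^{n\times n}$ and $B$ invertible and symmetric if and only if, for every integer $t\ge 0$, neither $(x-1)^{2t+1}$ nor $(x+1)^{2t+1}$ is an elementary divisor of $P$. Here the elementary divisors of $P$ are the powers $p_i^{e_i}$ (with $p_i\in K[x]$ monic irreducible and $e_i\ge 1$) in a decomposition $K^{2n}\cong\bigoplus_i K[x]/(p_i^{e_i})$ of $K[x]$-modules, where $x$ acts on $K^{2n}$ as $P$. -/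

import Mathlib

open Polynomial
open scoped DirectSum

/-- `q` is an elementary divisor of the square matrix `A` over the field `K`: the `K[X]`-module
`K^m`, on which `X` acts as `A`, is a finite direct sum of cyclic primary modules
`K[X] / (p i ^ e i)` with `p i` monic irreducible and `e i ≥ 1`, and `q` is one of the
prime powers `p i ^ e i`.  (The decomposition exists, and the family of the `p i ^ e i` is unique
up to order, so that it does not matter which decomposition is taken.) -/
def IsElementaryDivisor {K : Type*} [Field K] {m : Type*} [Fintype m] [DecidableEq m]
    (A : Matrix m m K) (q : K[X]) : Prop :=
  ∃ (r : ℕ) (p : Fin r → K[X]) (e : Fin r → ℕ),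
    (∀ i, (p i).Monic ∧ Irreducible (p i) ∧ 0 < e i) ∧
    Nonempty (Module.AEval' (Matrix.toLin' A) ≃ₗ[K[X]]
      ⨁ i : Fin r, K[X] ⧸ Ideal.span {p i ^ e i}) ∧
    ∃ i, q = p i ^ e i

/-!
A symplectic basis in which `P` has the shape `[[0, B], [-B⁻¹, D]]` with `B` symmetric is the same
thing as a *split Lagrangian*: a Lagrangian subspace `L` that is stable under `A = P + P⁻¹` and
complementary to `P L`. Indeed, the frame of `P L` dual to a frame of `L` completes it to such a
basis (`Matrix.exists_semiconj_fromBlocks`); the symmetry of `B` expresses the stability of `L`.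

The condition on elementary divisors is put in a form that needs no decomposition
(`isElementaryDivisor_X_sub_C_pow_iff`): with `N = P - ε`, there is a block of size exactly `k + 1`
at `ε` if and only if some vector of `ker N` lies in the range of `N ^ k` but not in that of
`N ^ (k + 1)`. The absence of odd blocks at `ε = ±1` is `NoOddBlocks`.

If `V = L ⊕ P L`, then `V` is induced from the `K[A]`-module `L` along `A = P + P⁻¹`, and as
`(P - ε)² = P (A - 2 ε)`, all blocks at `ε = ±1` have even size (`noOddBlocks_of_isCompl`).

For the converse, `A` is self-adjoint and, in every characteristic, `ω x (f(A) x) = 0` for all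
polynomials `f`, so that cyclic `K[A]`-submodules are isotropic. Primary components of `A` are
mutually orthogonal, which reduces the problem to the case that `q ^ (k + 1)` annihilates `V` and
`q ^ k` does not, for an irreducible `q`. Consider the bilinear form `β x y = ω x (P q(A) ^ k y)`.

* If `β v v ≠ 0` for some `v`, then `L = K[A] v` pairs perfectly with `P L`
  (`pairing_cyclicSpan`).
* If `β` is alternating, then `P` and `P⁻¹` agree on the image of `q(A) ^ k`, whence `q = X - 2 ε`
  with `ε = ±1`. As there is no block of size `2 k + 1`, some `v` has `(P - ε) q(A) ^ k v ≠ 0`, and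
  then `P⁻¹ q(A) ^ k v` is not in `K[A] v = (K[A] v)ᗮᗮ`. A vector `w` orthogonal to `K[A] v` but not
  to `P⁻¹ q(A) ^ k v` makes `L = K[A] v + K[A] w` isotropic and in perfect pairing with `P L`
  (`pairing_cyclicSpan_sup`). In characteristic other than two this case does not arise, but in
  characteristic two it does.

In both cases the form is nondegenerate on `L + P L`, and induction on the dimension applies to the
orthogonal complement (`IsSymplecticPair.exists_isSplitLagrangian`).
-/

/-! ### Jordan blocks and elementary divisors -/

/-- The element `x` is killed by `p` and divisible by `p ^ k` but not by `p ^ (k + 1)`. In a finite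
torsion module over `K[X]`, with `p` irreducible, such an `x` exists exactly when `p ^ (k + 1)` is
an elementary divisor. -/
def IsBlockWitness {R M : Type*} [CommRing R] [AddCommGroup M] [Module R M]
    (p : R) (k : ℕ) (x : M) : Prop :=
  p • x = 0 ∧ (∃ y, p ^ k • y = x) ∧ ¬ ∃ y, p ^ (k + 1) • y = x

lemma IsBlockWitness.map {R M N : Type*} [CommRing R] [AddCommGroup M] [Module R M]
    [AddCommGroup N] [Module R N] (e : M ≃ₗ[R] N) {p : R} {k : ℕ} {x : M}
    (h : IsBlockWitness p k x) : IsBlockWitness p k (e x) := by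
  obtain ⟨h1, ⟨y, h2⟩, h3⟩ := h
  refine ⟨by rw [← map_smul, h1, map_zero], ⟨e y, by rw [← map_smul, h2]⟩, ?_⟩
  rintro ⟨z, hz⟩
  exact h3 ⟨e.symm z, by rw [← map_smul, hz, e.symm_apply_apply]⟩

lemma exists_isBlockWitness_quotient {K : Type*} [Field K] {p : K[X]} (hp : p ≠ 0)
    (hpu : ¬ IsUnit p) (k : ℕ) :
    ∃ x : K[X] ⧸ Ideal.span {p ^ (k + 1)}, IsBlockWitness p k x := by
  refine ⟨Ideal.Quotient.mk _ (p ^ k), ?_, ⟨Ideal.Quotient.mk _ 1, ?_⟩, ?_⟩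
  · change Ideal.Quotient.mk _ (p * p ^ k) = 0
    rw [Ideal.Quotient.eq_zero_iff_mem, Ideal.mem_span_singleton, pow_succ']
  · change Ideal.Quotient.mk _ (p ^ k * 1) = _
    rw [mul_one]
  · rintro ⟨y, hy⟩
    obtain ⟨g, rfl⟩ := Ideal.Quotient.mk_surjective y
    change Ideal.Quotient.mk _ (p ^ (k + 1) * g) = _ at hy
    rw [Ideal.Quotient.eq, Ideal.mem_span_singleton, dvd_sub_right (dvd_mul_right _ _)] at hy
    exact hpu (isUnit_of_dvd_one
      ((mul_dvd_mul_iff_left (pow_ne_zero k hp)).1 (by rw [← pow_succ, mul_one]; exact hy)))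

/-- A cyclic primary module has a block witness for `p` of size `k + 1` only if it is
`K[X] / (p ^ (k + 1))`. -/
lemma IsBlockWitness.eq_of_quotient {K : Type*} [Field K] {p q : K[X]} (hp : p.Monic)
    (hpi : Irreducible p) (hq : q.Monic) (hqi : Irreducible q) {k e : ℕ}
    {x : K[X] ⧸ Ideal.span {q ^ e}} (h : IsBlockWitness p k x) : q = p ∧ e = k + 1 := by
  obtain ⟨h1, ⟨y, rfl⟩, h3⟩ := h
  obtain ⟨g, rfl⟩ := Ideal.Quotient.mk_surjective y
  have h1' : q ^ e ∣ p * (p ^ k * g) := by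
    rw [← Ideal.mem_span_singleton, ← Ideal.Quotient.eq_zero_iff_mem]; exact h1
  have h0 : ¬ q ^ e ∣ p ^ k * g := by
    intro h
    rw [← Ideal.mem_span_singleton, ← Ideal.Quotient.eq_zero_iff_mem] at h
    exact h3 ⟨0, by rw [smul_zero]; exact h.symm⟩
  have hqp : q = p := by
    by_contra hne
    have hc : IsCoprime q p := by
      rw [hqi.coprime_iff_not_dvd]
      intro hd
      exact hne (eq_of_monic_of_associated hq hp (hqi.associated_of_dvd hpi hd))
    exact h0 (hc.pow_left.dvd_of_dvd_mul_left h1')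
  subst hqp
  refine ⟨rfl, le_antisymm ?_ ?_⟩
  · by_contra! hlt
    obtain ⟨c, rfl⟩ := Nat.exists_eq_add_of_lt hlt
    have hd : q ^ (1 + c) ∣ g := by
      refine (mul_dvd_mul_iff_left (pow_ne_zero (k + 1) hq.ne_zero)).1 ?_
      convert h1' using 1 <;> ring
    obtain ⟨f, rfl⟩ := hd
    refine h3 ⟨Ideal.Quotient.mk _ (q ^ c * f), ?_⟩
    change Ideal.Quotient.mk _ (q ^ (k + 1) * (q ^ c * f)) =
      Ideal.Quotient.mk _ (q ^ k * (q ^ (1 + c) * f))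
    congr 1; ring
  · by_contra! hlt
    exact h0 (Dvd.dvd.mul_right (pow_dvd_pow _ (Nat.lt_succ_iff.1 hlt)) _)

lemma IsBlockWitness.exists_component {R ι : Type*} [CommRing R] [Fintype ι] {M : ι → Type*}
    [∀ i, AddCommGroup (M i)] [∀ i, Module R (M i)] {p : R} {k : ℕ} {x : ∀ i, M i}
    (h : IsBlockWitness p k x) : ∃ i, IsBlockWitness p k (x i) := by
  obtain ⟨h1, ⟨y, rfl⟩, h3⟩ := h
  by_contra! hcon
  have : ∀ i, ∃ z, p ^ (k + 1) • z = (p ^ k • y) i := by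
    intro i
    by_contra hi
    exact hcon i ⟨congrFun h1 i, ⟨y i, rfl⟩, hi⟩
  choose z hz using this
  exact h3 ⟨z, funext hz⟩

lemma IsBlockWitness.single {R ι : Type*} [CommRing R] [Fintype ι] [DecidableEq ι] {M : ι → Type*}
    [∀ i, AddCommGroup (M i)] [∀ i, Module R (M i)] {p : R} {k : ℕ} {i : ι} {x : M i}
    (h : IsBlockWitness p k x) : IsBlockWitness p k (Pi.single i x : ∀ i, M i) := by
  obtain ⟨h1, ⟨y, rfl⟩, h3⟩ := h
  refine ⟨?_, ⟨Pi.single i y, ?_⟩, ?_⟩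
  · rw [← Pi.single_smul, h1, Pi.single_zero]
  · rw [← Pi.single_smul]
  · rintro ⟨z, hz⟩
    exact h3 ⟨z i, by simpa using congrFun hz i⟩

/-- Trivial factors can be dropped from a product of modules. -/
lemma exists_linearEquiv_pi_subtype {R ι : Type*} [CommRing R] {M : ι → Type*}
    [∀ i, AddCommGroup (M i)] [∀ i, Module R (M i)] (s : ι → Prop)
    (hs : ∀ i, ¬ s i → Subsingleton (M i)) :
    Nonempty ((∀ i, M i) ≃ₗ[R] (∀ i : {i // s i}, M i)) := by
  classical
  refine ⟨LinearEquiv.ofBijective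
    (LinearMap.pi fun i : {i // s i} => LinearMap.proj (i : ι)) ⟨?_, ?_⟩⟩
  · intro f g hfg
    funext i
    by_cases hi : s i
    · exact congrFun hfg ⟨i, hi⟩
    · have := hs i hi
      exact Subsingleton.elim _ _
  · intro f
    refine ⟨fun i => if hi : s i then f ⟨i, hi⟩ else 0, ?_⟩
    funext i
    simp [i.2]

/-- The structure theorem for torsion modules over `K[X]`, with monic primes and nontrivial
exponents. -/
lemma exists_linearEquiv_pi_monic_primary {K M : Type*} [Field K] [AddCommGroup M] [Module K[X] M]
    [Module.Finite K[X] M] (hM : Module.IsTorsion K[X] M) :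
    ∃ (r : ℕ) (p : Fin r → K[X]) (e : Fin r → ℕ),
      (∀ i, (p i).Monic ∧ Irreducible (p i) ∧ 0 < e i) ∧
      Nonempty (M ≃ₗ[K[X]] ∀ i : Fin r, K[X] ⧸ Ideal.span {p i ^ e i}) := by
  classical
  obtain ⟨ι, _, p, hp, e, ⟨E⟩⟩ := Module.equiv_directSum_of_isTorsion hM
  obtain ⟨E₁⟩ := exists_linearEquiv_pi_subtype (R := K[X])
    (M := fun i : ι => K[X] ⧸ Ideal.span {p i ^ e i}) (fun i => 0 < e i) (by
      intro i hi
      rw [Nat.eq_zero_of_not_pos hi, pow_zero, Ideal.span_singleton_one]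
      exact Ideal.Quotient.subsingleton_iff.2 rfl)
  let f := Fintype.equivFin {i // 0 < e i}
  refine ⟨_, fun j => normalize (p (f.symm j)), fun j => e (f.symm j), fun j => ⟨?_, ?_, ?_⟩, ⟨?_⟩⟩
  · exact Polynomial.monic_normalize (hp _).ne_zero
  · exact (associated_normalize _).irreducible (hp _)
  · exact (f.symm j).2
  · refine E ≪≫ₗ (DirectSum.linearEquivFunOnFintype _ _ _) ≪≫ₗ E₁ ≪≫ₗ
      (LinearEquiv.piCongrLeft' K[X] _ f) ≪≫ₗ LinearEquiv.piCongrRight fun j =>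
        Submodule.quotEquivOfEq _ _ ?_
    exact Ideal.span_singleton_eq_span_singleton.2 ((associated_normalize _).pow_pow)

/-- Elementary divisors are read off from the `K[X]`-module structure: `p ^ (k + 1)` occurs if and
only if some element of the socle at `p` is divisible by `p ^ k` but not by `p ^ (k + 1)`. -/
lemma isElementaryDivisor_pow_iff {K : Type*} [Field K] {m : Type*} [Fintype m] [DecidableEq m]
    (A : Matrix m m K) {p : K[X]} (hp : p.Monic) (hpi : Irreducible p) (k : ℕ) :
    IsElementaryDivisor A (p ^ (k + 1)) ↔
      ∃ x : Module.AEval' (Matrix.toLin' A), IsBlockWitness p k x := by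
  classical
  constructor
  · rintro ⟨r, q, e, -, ⟨E⟩, i, hi⟩
    have h := exists_isBlockWitness_quotient hp.ne_zero hpi.not_isUnit k
    rw [hi] at h
    obtain ⟨x, hx⟩ := h
    exact ⟨_, (hx.single (M := fun i => K[X] ⧸ Ideal.span {q i ^ e i})).map
      ((DirectSum.linearEquivFunOnFintype K[X] _ _).symm ≪≫ₗ E.symm)⟩
  · rintro ⟨x, hx⟩
    obtain ⟨r, q, e, hq, ⟨E⟩⟩ := exists_linearEquiv_pi_monic_primary
      (Module.AEval.isTorsion_of_finiteDimensional K (m → K) (Matrix.toLin' A))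
    obtain ⟨i, hi⟩ := (hx.map E).exists_component
    obtain ⟨h1, h2⟩ := hi.eq_of_quotient hp hpi (hq i).1 (hq i).2.1
    exact ⟨r, q, e, hq, ⟨E ≪≫ₗ (DirectSum.linearEquivFunOnFintype K[X] _ _).symm⟩, i,
      by rw [h1, h2]⟩

lemma isElementaryDivisor_X_sub_C_pow_iff {K : Type*} [Field K] {m : Type*} [Fintype m]
    [DecidableEq m] (A : Matrix m m K) (c : K) (k : ℕ) :
    IsElementaryDivisor A ((X - C c) ^ (k + 1)) ↔
      ∃ x, (Matrix.toLin' A - algebraMap K _ c) x = 0 ∧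
        (∃ y, ((Matrix.toLin' A - algebraMap K _ c) ^ k) y = x) ∧
        ¬ ∃ y, ((Matrix.toLin' A - algebraMap K _ c) ^ (k + 1)) y = x := by
  rw [isElementaryDivisor_pow_iff A (monic_X_sub_C c) (irreducible_X_sub_C c)]
  have key : ∀ (j : ℕ) (y : m → K), (X - C c) ^ j • Module.AEval'.of (Matrix.toLin' A) y =
      Module.AEval'.of (Matrix.toLin' A) (((Matrix.toLin' A - algebraMap K _ c) ^ j) y) := by
    intro j y
    rw [Module.AEval'.of, ← Module.AEval.of_aeval_smul]
    simp
  have key1 := key 1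
  simp only [pow_one] at key1
  simp only [IsBlockWitness, (Module.AEval'.of (Matrix.toLin' A)).surjective.exists, key, key1,
    EmbeddingLike.apply_eq_iff_eq, EmbeddingLike.map_eq_zero_iff]

/-! ### Isometries of an alternating form -/

section Symplectic

variable {K V : Type*} [Field K] [AddCommGroup V] [Module K V]

/-- `P` is an isometry of the nondegenerate alternating form `ω`, with inverse `Q`. -/
structure IsSymplecticPair (ω : LinearMap.BilinForm K V) (P Q : Module.End K V) : Prop where
  alt : ω.IsAlt
  nondeg : ω.Nondegenerate
  right_inv : ∀ x, P (Q x) = x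
  left_inv : ∀ x, Q (P x) = x
  adj : ∀ x y, ω (P x) y = ω x (Q y)

/-- `P` has no Jordan blocks of odd size for the eigenvalues `1` and `-1`: a vector of the kernel
of `N = P - ε` that lies in the range of `N ^ (2 * t)` also lies in the range of
`N ^ (2 * t + 1)`. -/
def NoOddBlocks (P : Module.End K V) : Prop :=
  ∀ ε : K, ε ^ 2 = 1 → ∀ (t : ℕ) (x : V), (P - algebraMap K _ ε) x = 0 →
    (∃ y, ((P - algebraMap K _ ε) ^ (2 * t)) y = x) →
    ∃ y, ((P - algebraMap K _ ε) ^ (2 * t + 1)) y = x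

/-- `L` is an isotropic subspace that is stable under `P + Q` (where `Q` is the inverse of `P`) and
such that `U` is the direct sum of `L` and `P L`. When the form is nondegenerate on `U`, it is a
Lagrangian subspace of `U`. -/
structure IsSplitLagrangian (ω : LinearMap.BilinForm K V) (P Q : Module.End K V)
    (L U : Submodule K V) : Prop where
  isotropic : ∀ x ∈ L, ∀ y ∈ L, ω x y = 0
  stable : ∀ x ∈ L, (P + Q) x ∈ L
  disjoint : ∀ x ∈ L, ∀ y ∈ L, x = P y → x = 0
  mem_iff : ∀ u, u ∈ U ↔ ∃ x ∈ L, ∃ y ∈ L, x + P y = u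

/-- `(P - ε)² = P (P + P⁻¹ - 2 ε)` when `ε² = 1`. -/
lemma sub_algebraMap_sq {P Q : Module.End K V} (hPQ : P * Q = 1) {ε : K} (hε : ε ^ 2 = 1) :
    (P - algebraMap K _ ε) ^ 2 = P * (P + Q - algebraMap K _ (2 * ε)) := by
  have hεε : algebraMap K (Module.End K V) ε * algebraMap K (Module.End K V) ε = 1 := by
    rw [← map_mul, ← sq, hε, map_one]
  rw [sq, mul_sub, mul_sub, sub_mul, sub_mul, hεε, mul_add, hPQ, map_mul, map_ofNat,
    Algebra.commutes ε P]
  rw [show P * (2 * algebraMap K (Module.End K V) ε) = 2 * (P * algebraMap K _ ε) by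
    rw [← mul_assoc, mul_two, ← two_mul, mul_assoc]]
  rw [two_mul]; abel

/-- If `V = L ⊕ P L` with `L` stable under `P + P⁻¹`, then `V` is induced from a module over
`K[P + P⁻¹]`, in which the primary components at `±1` have even exponents. -/
lemma noOddBlocks_of_isCompl {P Q : Module.End K V} (hPQ : P * Q = 1) (hQP : Q * P = 1)
    {L : Submodule K V} (hL : ∀ x ∈ L, (P + Q) x ∈ L) (hc : IsCompl L (L.map P)) :
    NoOddBlocks P := by
  intro ε hε t x hx hy
  obtain ⟨y, hy⟩ := hy
  set N := P - algebraMap K (Module.End K V) ε with hN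
  set E := P + Q - algebraMap K (Module.End K V) (2 * ε) with hE
  have hPQc : Commute P Q := by rw [Commute, SemiconjBy, hPQ, hQP]
  have hPE : Commute P E :=
    ((Commute.refl P).add_right hPQc).sub_right (Algebra.commutes _ _).symm
  have hN2 : N ^ 2 = P * E := sub_algebraMap_sq hPQ hε
  have hN2t : N ^ (2 * t) = E ^ t * P ^ t := by
    rw [pow_mul, hN2, hPE.eq, hPE.symm.mul_pow]
  have hEt : E ^ t = N ^ (2 * t) * Q ^ t := by
    rw [hN2t, mul_assoc, ← hPQc.mul_pow, hPQ, one_pow, mul_one]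
  have hEL : ∀ x ∈ L, (E ^ t) x ∈ L := by
    have h1 : ∀ x ∈ L, E x ∈ L := by
      intro x hx
      rw [hE, LinearMap.sub_apply, Module.algebraMap_end_apply]
      exact L.sub_mem (hL x hx) (L.smul_mem _ hx)
    exact fun x hx => Module.End.pow_apply_mem_of_forall_mem t h1 x hx
  -- comparing the components of `P x = ε x` along `L` and `P L` gives `x = (P - ε) b`
  obtain ⟨l₁, hl₁, z, ⟨l₂, hl₂, rfl⟩, hw⟩ :=
    Submodule.mem_sup.1 ((hc.sup_eq_top ▸ Submodule.mem_top : (P ^ t) y ∈ L ⊔ L.map P))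
  set a := (E ^ t) l₁ with ha
  set b := (E ^ t) l₂ with hb
  have haL : a ∈ L := hEL _ hl₁
  have hbL : b ∈ L := hEL _ hl₂
  have hxab : x = a + P b := by
    rw [← hy, hN2t, Module.End.mul_apply, ← hw, map_add, ha, hb, ← Module.End.mul_apply,
      ← Module.End.mul_apply, (hPE.pow_right t).eq]
  have hP2 : P (P b) = P ((P + Q) b) - b := by
    rw [LinearMap.add_apply, map_add, ← Module.End.mul_apply P Q, hPQ, Module.End.one_apply,
      add_sub_cancel_right]
  have hPx : P x = ε • x := by
    rw [hN, LinearMap.sub_apply, Module.algebraMap_end_apply, sub_eq_zero] at hx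
    exact hx
  have hab : ε • a + b = 0 := by
    refine Submodule.disjoint_def.1 hc.disjoint _
      (L.add_mem (L.smul_mem _ haL) hbL) ⟨a + (P + Q) b - ε • b, ?_, ?_⟩
    · exact L.sub_mem (L.add_mem haL (hL _ hbL)) (L.smul_mem _ hbL)
    · rw [hxab, map_add, hP2, smul_add] at hPx
      rw [map_sub, map_add, map_smul]
      rw [← sub_eq_zero] at hPx ⊢
      rw [← hPx]
      abel
  have haε : a = - ε • b := by
    have := congrArg (ε • ·) hab
    simp only [smul_add, smul_smul, ← sq, hε, one_smul, smul_zero] at this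
    rw [neg_smul]
    exact eq_neg_of_add_eq_zero_left this
  refine ⟨(Q ^ t) l₂, ?_⟩
  rw [pow_succ', Module.End.mul_apply, ← Module.End.mul_apply _ (Q ^ t), ← hEt, ← hb, hxab, haε,
    hN, LinearMap.sub_apply,
    Module.algebraMap_end_apply, neg_smul]
  abel

/-! ### The algebra generated by `P + P⁻¹` -/

namespace IsSymplecticPair

variable {ω : LinearMap.BilinForm K V} {P Q : Module.End K V} (h : IsSymplecticPair ω P Q)
include h

lemma mul_eq_one : P * Q = 1 := LinearMap.ext h.right_inv

lemma mul_eq_one' : Q * P = 1 := LinearMap.ext h.left_inv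

lemma adj' (x y : V) : ω (Q x) y = ω x (P y) := by
  rw [← h.left_inv y, ← h.adj, h.right_inv, h.left_inv]

lemma swap (x y : V) : ω x y = - ω y x := (h.alt.neg_eq y x).symm

lemma commute_aeval_left (f : K[X]) : Commute P (aeval (P + Q) f) := by
  have hPQc : Commute P Q := by rw [Commute, SemiconjBy, h.mul_eq_one, h.mul_eq_one']
  have := ((Commute.refl P).add_right hPQc)
  induction f using Polynomial.induction_on' with
  | add p q hp hq => rw [map_add]; exact hp.add_right hq
  | monomial n a =>
    rw [aeval_monomial]
    exact Commute.mul_right (Algebra.commutes _ _).symm (this.pow_right n)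

lemma apply_aeval (f : K[X]) (x : V) : P (aeval (P + Q) f x) = aeval (P + Q) f (P x) :=
  LinearMap.congr_fun (h.commute_aeval_left f).eq x

lemma inv_apply_aeval (f : K[X]) (x : V) : Q (aeval (P + Q) f x) = aeval (P + Q) f (Q x) := by
  rw [← h.left_inv (aeval (P + Q) f (Q x)), h.apply_aeval, h.right_inv]

/-- Polynomials in `P + P⁻¹` are self-adjoint. -/
lemma aeval_adj (f : K[X]) (x y : V) :
    ω (aeval (P + Q) f x) y = ω x (aeval (P + Q) f y) := by
  induction f using Polynomial.induction_on' with
  | add p q hp hq => simp only [map_add, LinearMap.add_apply, hp, hq]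
  | monomial n a =>
    have hn : ∀ (n : ℕ) (y : V), ω (((P + Q) ^ n) x) y = ω x (((P + Q) ^ n) y) := by
      intro n
      induction n with
      | zero => intro y; rfl
      | succ n ih =>
        intro y
        rw [pow_succ', Module.End.mul_apply, ← pow_succ', pow_succ, Module.End.mul_apply, ← ih]
        simp only [LinearMap.add_apply, map_add, h.adj, h.adj']
        rw [add_comm]
    simp only [aeval_monomial, Module.End.mul_apply, Module.algebraMap_end_apply, map_smul,
      LinearMap.smul_apply, hn]

/-- Every cyclic `K[P + P⁻¹]`-submodule is isotropic, in every characteristic. -/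
lemma aeval_self (f : K[X]) (x : V) : ω x (aeval (P + Q) f x) = 0 := by
  induction f using Polynomial.induction_on' with
  | add p q hp hq => simp only [map_add, LinearMap.add_apply, hp, hq, add_zero]
  | monomial n a =>
    have hX : ∀ (n : ℕ) (y : V), ((P + Q) ^ n) y = aeval (P + Q) (X ^ n : K[X]) y := by simp
    have hn : ω x (((P + Q) ^ n) x) = 0 := by
      obtain ⟨k, rfl | rfl⟩ := n.even_or_odd'
      · rw [two_mul, pow_add, Module.End.mul_apply, hX, ← h.aeval_adj, ← hX]
        exact h.alt _
      · rw [two_mul, add_assoc, pow_add, Module.End.mul_apply, hX, ← h.aeval_adj, ← hX, pow_succ',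
          Module.End.mul_apply, LinearMap.add_apply, map_add, ← h.adj, h.swap, neg_add_cancel]
    rw [aeval_monomial, Module.End.mul_apply, Module.algebraMap_end_apply, map_smul, hn,
      smul_zero]

end IsSymplecticPair

/-! ### Invariant subspaces -/

/-- The span of the orbit of `v` under the polynomials in `A`, that is, the cyclic
`K[A]`-submodule generated by `v`. -/
noncomputable def cyclicSpan (A : Module.End K V) (v : V) : Submodule K V :=
  LinearMap.range ((LinearMap.applyₗ v).comp (aeval A).toLinearMap)

lemma mem_cyclicSpan {A : Module.End K V} {v x : V} :
    x ∈ cyclicSpan A v ↔ ∃ f : K[X], aeval A f v = x := Iff.rfl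

lemma self_mem_cyclicSpan (A : Module.End K V) (v : V) : v ∈ cyclicSpan A v :=
  ⟨1, by simp⟩

lemma map_mem_cyclicSpan {A : Module.End K V} {v x : V} (hx : x ∈ cyclicSpan A v) :
    A x ∈ cyclicSpan A v := by
  obtain ⟨f, rfl⟩ := mem_cyclicSpan.1 hx
  exact mem_cyclicSpan.2 ⟨X * f, by simp⟩

/-- The absence of odd blocks passes to an invariant direct summand. -/
lemma NoOddBlocks.restrict {P : Module.End K V} (h : NoOddBlocks P) {U W : Submodule K V}
    (hU : ∀ x ∈ U, P x ∈ U) (hW : ∀ x ∈ W, P x ∈ W) (hUW : IsCompl U W) :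
    NoOddBlocks (P.restrict hU) := by
  intro ε hε t x hx hy
  obtain ⟨y, hy⟩ := hy
  have hN : ∀ S : Submodule K V, (∀ x ∈ S, P x ∈ S) →
      ∀ z ∈ S, (P - algebraMap K (Module.End K V) ε) z ∈ S := fun S hS z hz => by
    rw [LinearMap.sub_apply, Module.algebraMap_end_apply]
    exact S.sub_mem (hS z hz) (S.smul_mem _ hz)
  have hr : P.restrict hU - algebraMap K (Module.End K U) ε =
      (P - algebraMap K (Module.End K V) ε).restrict (hN U hU) := rfl
  rw [hr] at hx hy ⊢
  have hpow : ∀ (n : ℕ) (z : U), (((P - algebraMap K (Module.End K V) ε).restrict (hN U hU) ^ n) z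
      : V) = ((P - algebraMap K (Module.End K V) ε) ^ n) z := by
    intro n z
    rw [Module.End.pow_restrict]
    rfl
  obtain ⟨z, hz⟩ := h ε hε t x (congrArg Subtype.val hx)
    ⟨y, by rw [← hpow, hy]⟩
  obtain ⟨z₁, hz₁, z₂, hz₂, rfl⟩ :=
    Submodule.mem_sup.1 ((hUW.sup_eq_top ▸ Submodule.mem_top : z ∈ U ⊔ W))
  refine ⟨⟨z₁, hz₁⟩, Subtype.ext ?_⟩
  rw [hpow]
  rw [map_add] at hz
  have h2 := Module.End.pow_apply_mem_of_forall_mem (2 * t + 1) (hN W hW) z₂ hz₂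
  have h1 := Module.End.pow_apply_mem_of_forall_mem (2 * t + 1) (hN U hU) z₁ hz₁
  have h3 : ((P - algebraMap K (Module.End K V) ε) ^ (2 * t + 1)) z₂ = 0 := by
    refine Submodule.disjoint_def.1 hUW.disjoint _ ?_ h2
    rw [eq_sub_of_add_eq' hz]
    exact U.sub_mem x.2 h1
  rwa [h3, add_zero] at hz

/-- Split Lagrangians of orthogonal, independent invariant subspaces add up. -/
lemma IsSplitLagrangian.sup {ω : LinearMap.BilinForm K V} {P Q : Module.End K V}
    {L₁ L₂ U W : Submodule K V} (h₁ : IsSplitLagrangian ω P Q L₁ U)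
    (h₂ : IsSplitLagrangian ω P Q L₂ W) (hd : Disjoint U W)
    (ho : ∀ x ∈ U, ∀ y ∈ W, ω x y = 0) (ho' : ∀ x ∈ U, ∀ y ∈ W, ω y x = 0) :
    IsSplitLagrangian ω P Q (L₁ ⊔ L₂) (U ⊔ W) := by
  have hL₁ : ∀ x ∈ L₁, x ∈ U := fun x hx => (h₁.mem_iff x).2 ⟨x, hx, 0, L₁.zero_mem, by simp⟩
  have hL₂ : ∀ x ∈ L₂, x ∈ W := fun x hx => (h₂.mem_iff x).2 ⟨x, hx, 0, L₂.zero_mem, by simp⟩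
  have hP₁ : ∀ x ∈ L₁, P x ∈ U := fun x hx => (h₁.mem_iff _).2 ⟨0, L₁.zero_mem, x, hx, by simp⟩
  have hP₂ : ∀ x ∈ L₂, P x ∈ W := fun x hx => (h₂.mem_iff _).2 ⟨0, L₂.zero_mem, x, hx, by simp⟩
  refine ⟨?_, ?_, ?_, ?_⟩
  · intro x hx y hy
    obtain ⟨x₁, hx₁, x₂, hx₂, rfl⟩ := Submodule.mem_sup.1 hx
    obtain ⟨y₁, hy₁, y₂, hy₂, rfl⟩ := Submodule.mem_sup.1 hy
    simp only [map_add, LinearMap.add_apply]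
    rw [h₁.isotropic x₁ hx₁ y₁ hy₁, h₂.isotropic x₂ hx₂ y₂ hy₂, ho x₁ (hL₁ _ hx₁) y₂ (hL₂ _ hy₂),
      ho' y₁ (hL₁ _ hy₁) x₂ (hL₂ _ hx₂)]
    simp
  · intro x hx
    obtain ⟨x₁, hx₁, x₂, hx₂, rfl⟩ := Submodule.mem_sup.1 hx
    rw [map_add]
    exact Submodule.add_mem_sup (h₁.stable _ hx₁) (h₂.stable _ hx₂)
  · intro x hx y hy hxy
    obtain ⟨x₁, hx₁, x₂, hx₂, rfl⟩ := Submodule.mem_sup.1 hx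
    obtain ⟨y₁, hy₁, y₂, hy₂, rfl⟩ := Submodule.mem_sup.1 hy
    rw [map_add] at hxy
    have hs : x₁ - P y₁ = P y₂ - x₂ := by rw [sub_eq_sub_iff_add_eq_add, hxy, add_comm]
    have h0 : x₁ - P y₁ = 0 := by
      refine Submodule.disjoint_def.1 hd _ (U.sub_mem (hL₁ _ hx₁) (hP₁ _ hy₁)) ?_
      rw [hs]
      exact W.sub_mem (hP₂ _ hy₂) (hL₂ _ hx₂)
    rw [h₁.disjoint x₁ hx₁ y₁ hy₁ (sub_eq_zero.1 h0),
      h₂.disjoint x₂ hx₂ y₂ hy₂ (sub_eq_zero.1 (hs ▸ h0)).symm, add_zero]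
  · intro u
    constructor
    · intro hu
      obtain ⟨u₁, hu₁, u₂, hu₂, rfl⟩ := Submodule.mem_sup.1 hu
      obtain ⟨x₁, hx₁, y₁, hy₁, rfl⟩ := (h₁.mem_iff _).1 hu₁
      obtain ⟨x₂, hx₂, y₂, hy₂, rfl⟩ := (h₂.mem_iff _).1 hu₂
      exact ⟨_, Submodule.add_mem_sup hx₁ hx₂, _, Submodule.add_mem_sup hy₁ hy₂, by
        rw [map_add]; abel⟩
    · rintro ⟨x, hx, y, hy, rfl⟩
      obtain ⟨x₁, hx₁, x₂, hx₂, rfl⟩ := Submodule.mem_sup.1 hx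
      obtain ⟨y₁, hy₁, y₂, hy₂, rfl⟩ := Submodule.mem_sup.1 hy
      rw [map_add, add_add_add_comm]
      exact Submodule.add_mem_sup (U.add_mem (hL₁ _ hx₁) (hP₁ _ hy₁))
        (W.add_mem (hL₂ _ hx₂) (hP₂ _ hy₂))

/-- A split Lagrangian of a subspace, seen as a space of its own, is one in the ambient space. -/
lemma IsSplitLagrangian.map_subtype {ω : LinearMap.BilinForm K V} {P Q : Module.End K V}
    {U : Submodule K V} {hP : ∀ x ∈ U, P x ∈ U} {hQ : ∀ x ∈ U, Q x ∈ U} {L : Submodule K U}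
    (h : IsSplitLagrangian (ω.restrict U) (P.restrict hP) (Q.restrict hQ) L ⊤) :
    IsSplitLagrangian ω P Q (L.map U.subtype) U := by
  refine ⟨?_, ?_, ?_, ?_⟩
  · rintro _ ⟨x, hx, rfl⟩ _ ⟨y, hy, rfl⟩
    exact h.isotropic x hx y hy
  · rintro _ ⟨x, hx, rfl⟩
    exact ⟨_, h.stable x hx, rfl⟩
  · rintro _ ⟨x, hx, rfl⟩ _ ⟨y, hy, rfl⟩ hxy
    rw [h.disjoint x hx y hy (Subtype.ext hxy), map_zero]
  · intro u
    constructor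
    · intro hu
      obtain ⟨x, hx, y, hy, hxy⟩ := (h.mem_iff ⟨u, hu⟩).1 Submodule.mem_top
      exact ⟨_, ⟨x, hx, rfl⟩, _, ⟨y, hy, rfl⟩, congrArg Subtype.val hxy⟩
    · rintro ⟨_, ⟨x, hx, rfl⟩, _, ⟨y, hy, rfl⟩, rfl⟩
      exact U.add_mem x.2 (hP _ y.2)

namespace IsSymplecticPair

variable {ω : LinearMap.BilinForm K V} {P Q : Module.End K V} (h : IsSymplecticPair ω P Q)
include h

lemma restrict {U : Submodule K V} (hP : ∀ x ∈ U, P x ∈ U) (hQ : ∀ x ∈ U, Q x ∈ U)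
    (hd : Disjoint U (ω.orthogonal U)) :
    IsSymplecticPair (ω.restrict U) (P.restrict hP) (Q.restrict hQ) where
  alt x := h.alt x
  nondeg := ω.nondegenerate_restrict_of_disjoint_orthogonal h.alt.isRefl hd
  right_inv x := Subtype.ext (h.right_inv x)
  left_inv x := Subtype.ext (h.left_inv x)
  adj x y := h.adj x y

lemma orthogonal_stable {U : Submodule K V} (hQ : ∀ x ∈ U, Q x ∈ U) :
    ∀ x ∈ ω.orthogonal U, P x ∈ ω.orthogonal U := by
  intro x hx y hy
  change ω y (P x) = 0
  rw [← h.adj']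
  exact hx _ (hQ _ hy)

lemma orthogonal_stable' {U : Submodule K V} (hP : ∀ x ∈ U, P x ∈ U) :
    ∀ x ∈ ω.orthogonal U, Q x ∈ ω.orthogonal U := by
  intro x hx y hy
  change ω y (Q x) = 0
  rw [← h.adj]
  exact hx _ (hP _ hy)

lemma eq_zero_of_forall {x : V} (hx : ∀ y, ω x y = 0) : x = 0 := h.nondeg.1 x hx

/-- An isotropic `(P + P⁻¹)`-stable subspace `L` that pairs perfectly with `P L` is a split
Lagrangian of `L + P L`, on which the form is nondegenerate. -/
lemma isSplitLagrangian_of_pairing {L : Submodule K V}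
    (hiso : ∀ x ∈ L, ∀ y ∈ L, ω x y = 0) (hst : ∀ x ∈ L, (P + Q) x ∈ L)
    (hpair : ∀ x ∈ L, (∀ y ∈ L, ω x (P y) = 0) → x = 0) :
    ∃ U, L ≤ U ∧ IsSplitLagrangian ω P Q L U ∧ (∀ x ∈ U, P x ∈ U) ∧ (∀ x ∈ U, Q x ∈ U) ∧
      Disjoint U (ω.orthogonal U) := by
  have hPP : ∀ x y, ω (P x) (P y) = ω x y := fun x y => by rw [h.adj, h.left_inv]
  have hQ : ∀ y, Q y = (P + Q) y - P y := fun y => by simp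
  have hPP' : ∀ y, P (P y) = P ((P + Q) y) - y := fun y => by simp [h.right_inv]
  have hLP : ∀ u, u ∈ L ⊔ L.map P ↔ ∃ x ∈ L, ∃ y ∈ L, x + P y = u := fun u => by
    rw [Submodule.mem_sup]; simp
  refine ⟨L ⊔ L.map P, le_sup_left, ⟨hiso, hst, ?_, hLP⟩, ?_, ?_, ?_⟩
  · rintro x hx y hy rfl
    exact hpair _ hx fun z hz => by rw [hPP]; exact hiso y hy z hz
  · intro u hu
    obtain ⟨x, hx, y, hy, rfl⟩ := (hLP u).1 hu
    exact (hLP _).2 ⟨-y, L.neg_mem hy, x + (P + Q) y, L.add_mem hx (hst _ hy), by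
      rw [map_add, map_add, hPP']; abel⟩
  · intro u hu
    obtain ⟨x, hx, y, hy, rfl⟩ := (hLP u).1 hu
    exact (hLP _).2 ⟨(P + Q) x + y, L.add_mem (hst _ hx) hy, -x, L.neg_mem hx, by
      rw [map_add, h.left_inv, hQ, map_neg]; abel⟩
  · rw [Submodule.disjoint_def]
    intro u hu hu'
    obtain ⟨x, hx, y, hy, rfl⟩ := (hLP u).1 hu
    have hort : ∀ z ∈ L ⊔ L.map P, ω (x + P y) z = 0 := fun z hz => by
      rw [h.swap, neg_eq_zero]; exact hu' z hz
    have hx0 : x = 0 := hpair x hx fun z hz => by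
      have := hort (P z) ((hLP _).2 ⟨0, L.zero_mem, z, hz, by simp⟩)
      rwa [map_add, LinearMap.add_apply, hPP, hiso y hy z hz, add_zero] at this
    have hy0 : y = 0 := hpair y hy fun z hz => by
      have := hort z ((hLP _).2 ⟨z, hz, 0, L.zero_mem, by simp⟩)
      rwa [hx0, zero_add, h.adj, hQ, map_sub, hiso y hy _ (hst z hz), zero_sub,
        neg_eq_zero] at this
    rw [hx0, hy0, map_zero, add_zero]

/-- Polynomials in `P + P⁻¹` can be moved across the pairing `ω x (P y)`. -/
lemma pairing_aeval (f g : K[X]) (x y : V) :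
    ω (aeval (P + Q) f x) (P (aeval (P + Q) g y)) = ω x (P (aeval (P + Q) (f * g) y)) := by
  rw [h.aeval_adj, ← h.apply_aeval, map_mul, Module.End.mul_apply]

end IsSymplecticPair

/-! ### Existence of split Lagrangians -/

lemma exists_mul_add_eq_pow_of_not_dvd {q f : K[X]} (hq : Irreducible q) {k : ℕ}
    (hf : ¬ q ^ (k + 1) ∣ f) : ∃ a b, f * a + q ^ (k + 1) * b = q ^ k := by
  classical
  obtain ⟨i, hi, hass⟩ := (dvd_prime_pow hq.prime (k + 1)).1
    (EuclideanDomain.gcd_dvd_right f (q ^ (k + 1)))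
  have hik : i ≤ k := by
    by_contra! hlt
    obtain rfl : i = k + 1 := by omega
    exact hf (hass.symm.dvd.trans (EuclideanDomain.gcd_dvd_left _ _))
  obtain ⟨c, hc⟩ := hass.dvd.trans (pow_dvd_pow q hik)
  refine ⟨EuclideanDomain.gcdA f (q ^ (k + 1)) * c, EuclideanDomain.gcdB f (q ^ (k + 1)) * c, ?_⟩
  rw [hc, EuclideanDomain.gcd_eq_gcd_ab f (q ^ (k + 1))]
  ring

namespace IsSymplecticPair

variable {ω : LinearMap.BilinForm K V} {P Q : Module.End K V} (h : IsSymplecticPair ω P Q)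
include h

/-- If `q ^ (k + 1)` annihilates `V` and `ω v (P (q ^ k) v) ≠ 0`, then the cyclic module of `v`
pairs perfectly with its image under `P`. -/
lemma pairing_cyclicSpan {q : K[X]} (hq : Irreducible q) {k : ℕ}
    (hk : aeval (P + Q) (q ^ (k + 1)) = 0) {v : V}
    (hv : ω v (P (aeval (P + Q) (q ^ k) v)) ≠ 0) :
    ∀ x ∈ cyclicSpan (P + Q) v, (∀ y ∈ cyclicSpan (P + Q) v, ω x (P y) = 0) → x = 0 := by
  intro x hx hxy
  obtain ⟨f, rfl⟩ := mem_cyclicSpan.1 hx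
  by_cases hf : q ^ (k + 1) ∣ f
  · obtain ⟨g, rfl⟩ := hf
    rw [map_mul, hk, zero_mul, LinearMap.zero_apply]
  · obtain ⟨a, b, hab⟩ := exists_mul_add_eq_pow_of_not_dvd hq hf
    refine absurd ?_ hv
    have := hxy _ (mem_cyclicSpan.2 ⟨a, rfl⟩)
    rwa [h.pairing_aeval, eq_sub_of_add_eq hab, map_sub, map_mul _ (q ^ (k + 1)), hk, zero_mul,
      sub_zero] at this

/-- If `(X - c) ^ (k + 1)` annihilates `V` and the pairing `ω x (P (X - c) ^ k y)` is hyperbolic on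
`v, w`, then the module spanned by `v, w` pairs perfectly with its image under `P`. -/
lemma pairing_cyclicSpan_sup {c : K} {k : ℕ}
    (hk : aeval (P + Q) ((X - C c) ^ (k + 1)) = 0) {v w : V}
    (hvv : ω v (P (aeval (P + Q) ((X - C c) ^ k) v)) = 0)
    (hww : ω w (P (aeval (P + Q) ((X - C c) ^ k) w)) = 0)
    (hvw : ω v (P (aeval (P + Q) ((X - C c) ^ k) w)) ≠ 0)
    (hwv : ω w (P (aeval (P + Q) ((X - C c) ^ k) v)) ≠ 0) :
    ∀ x ∈ cyclicSpan (P + Q) v ⊔ cyclicSpan (P + Q) w,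
      (∀ y ∈ cyclicSpan (P + Q) v ⊔ cyclicSpan (P + Q) w, ω x (P y) = 0) → x = 0 := by
  intro x hx hxy
  obtain ⟨x₁, hx₁, x₂, hx₂, rfl⟩ := Submodule.mem_sup.1 hx
  obtain ⟨f, rfl⟩ := mem_cyclicSpan.1 hx₁
  obtain ⟨g, rfl⟩ := mem_cyclicSpan.1 hx₂
  -- on the image of `(X - c) ^ k` a polynomial acts through its value at `c`
  have heval : ∀ (r : K[X]) (y : V), aeval (P + Q) (r * (X - C c) ^ k) y =
      r.eval c • aeval (P + Q) ((X - C c) ^ k) y := by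
    intro r y
    obtain ⟨s, hs⟩ := X_sub_C_dvd_sub_C_eval (a := c) (p := r)
    rw [eq_add_of_sub_eq hs, add_mul, map_add,
      show (X - C c) * s * (X - C c) ^ k = s * (X - C c) ^ (k + 1) by ring, map_mul _ s, hk,
      mul_zero, zero_add, map_mul, aeval_C, Module.End.mul_apply, Module.algebraMap_end_apply]
    simp
  -- divisibility of both coefficients by `(X - c) ^ j` is raised one step at a time
  have hdvd : ∀ j ≤ k + 1, (X - C c) ^ j ∣ f ∧ (X - C c) ^ j ∣ g := by
    intro j
    induction j with
    | zero => simp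
    | succ j ih =>
      intro hj
      obtain ⟨⟨f', hf'⟩, ⟨g', hg'⟩⟩ := ih (by omega)
      have key : ∀ y, y ∈ cyclicSpan (P + Q) v ⊔ cyclicSpan (P + Q) w →
          f'.eval c * ω v (P (aeval (P + Q) ((X - C c) ^ k) y)) +
            g'.eval c * ω w (P (aeval (P + Q) ((X - C c) ^ k) y)) = 0 := by
        intro y hy
        have hy' : aeval (P + Q) ((X - C c) ^ (k - j)) y ∈
            cyclicSpan (P + Q) v ⊔ cyclicSpan (P + Q) w := by
          obtain ⟨y₁, hy₁, y₂, hy₂, rfl⟩ := Submodule.mem_sup.1 hy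
          obtain ⟨a, rfl⟩ := mem_cyclicSpan.1 hy₁
          obtain ⟨b, rfl⟩ := mem_cyclicSpan.1 hy₂
          rw [map_add]
          exact Submodule.add_mem_sup ⟨(X - C c) ^ (k - j) * a, by simp⟩
            ⟨(X - C c) ^ (k - j) * b, by simp⟩
        have h0 := hxy _ hy'
        have hmul : ∀ r : K[X], (X - C c) ^ j * r * (X - C c) ^ (k - j) = r * (X - C c) ^ k := by
          intro r
          rw [mul_right_comm, ← pow_add, Nat.add_sub_cancel' (by omega), mul_comm]
        rw [map_add, LinearMap.add_apply, h.pairing_aeval, h.pairing_aeval, hf', hg', hmul, hmul,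
          heval, heval] at h0
        simpa using h0
      have hg0 := key v (Submodule.mem_sup_left (self_mem_cyclicSpan _ _))
      have hf0 := key w (Submodule.mem_sup_right (self_mem_cyclicSpan _ _))
      rw [hvv, mul_zero, zero_add, mul_eq_zero, or_iff_left hwv] at hg0
      rw [hww, mul_zero, add_zero, mul_eq_zero, or_iff_left hvw] at hf0
      obtain ⟨f'', rfl⟩ := dvd_iff_isRoot.2 hf0
      obtain ⟨g'', rfl⟩ := dvd_iff_isRoot.2 hg0
      exact ⟨⟨f'', by rw [hf', pow_succ, mul_assoc]⟩, ⟨g'', by rw [hg', pow_succ, mul_assoc]⟩⟩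
  obtain ⟨⟨f', rfl⟩, ⟨g', rfl⟩⟩ := hdvd (k + 1) le_rfl
  simp only [map_mul _ ((X - C c) ^ (k + 1)), hk, zero_mul, LinearMap.zero_apply, add_zero]

/-- If `ω v (P D v)` vanishes identically, where `D` is a polynomial in `P + P⁻¹`, then
`P D = P⁻¹ D`: the alternating form `ω v (P D w)` is skew-symmetric. -/
lemma apply_aeval_eq_of_alternating {D : K[X]}
    (hD : ∀ v, ω v (P (aeval (P + Q) D v)) = 0) (v : V) :
    P (aeval (P + Q) D v) = Q (aeval (P + Q) D v) := by
  rw [← sub_eq_zero]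
  refine h.eq_zero_of_forall fun w => ?_
  have h1 := hD (v + w)
  simp only [map_add, LinearMap.add_apply, hD, zero_add, add_zero] at h1
  rw [map_sub, LinearMap.sub_apply, h.adj', h.aeval_adj, ← h.apply_aeval, h.swap (P _) w]
  linear_combination -h1

/-- In the alternating case the prime `q` is `X - 2 ε` with `ε = ±1`, because `(P + P⁻¹)² = 4` on
the image of `q ^ k`. -/
lemma exists_eq_X_sub_C_of_alternating {q : K[X]} (hqm : q.Monic) (hq : Irreducible q) {k : ℕ}
    (hk : aeval (P + Q) (q ^ (k + 1)) = 0) (hk' : aeval (P + Q) (q ^ k) ≠ 0)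
    (hD : ∀ v, P (aeval (P + Q) (q ^ k) v) = Q (aeval (P + Q) (q ^ k) v)) :
    ∃ ε : K, ε ^ 2 = 1 ∧ q = X - C (2 * ε) := by
  have hA : ∀ v, aeval (P + Q) ((X - C 2) * (X + C 2) : K[X]) (aeval (P + Q) (q ^ k) v) = 0 := by
    intro v
    have h1 : (P + Q) (aeval (P + Q) (q ^ k) v) = (2 : K) • P (aeval (P + Q) (q ^ k) v) := by
      rw [LinearMap.add_apply, ← hD, two_smul]
    have h2 : (P + Q) (P (aeval (P + Q) (q ^ k) v)) = (2 : K) • (aeval (P + Q) (q ^ k) v) := by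
      rw [LinearMap.add_apply, h.left_inv, hD, h.right_inv, two_smul]
    simp only [map_mul, map_add, map_sub, aeval_X, aeval_C, Module.End.mul_apply,
      LinearMap.add_apply (P + Q) (algebraMap K _ 2), LinearMap.sub_apply (P + Q),
      Module.algebraMap_end_apply, h1, h2, map_smul]
    module
  have hdvd : q ∣ (X - C 2) * (X + C 2) := by
    by_contra hn
    obtain ⟨a, b, hab⟩ := (hq.coprime_iff_not_dvd.2 hn)
    refine hk' (LinearMap.ext fun v => ?_)
    have : aeval (P + Q) (a * q + b * ((X - C 2) * (X + C 2))) (aeval (P + Q) (q ^ k) v) = 0 := by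
      rw [map_add, LinearMap.add_apply, map_mul _ b, Module.End.mul_apply, hA, map_zero, add_zero,
        ← Module.End.mul_apply, ← map_mul, mul_assoc, ← pow_succ', map_mul, hk, mul_zero,
        LinearMap.zero_apply]
    rwa [hab, map_one, Module.End.one_apply] at this
  rcases hq.prime.dvd_or_dvd hdvd with h1 | h1
  · refine ⟨1, by simp, eq_of_monic_of_associated hqm (monic_X_sub_C _) ?_⟩
    rw [mul_one]
    exact hq.associated_of_dvd (irreducible_X_sub_C _) h1
  · refine ⟨-1, by simp, eq_of_monic_of_associated hqm (monic_X_sub_C _) ?_⟩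
    have : (X : K[X]) - C (2 * -1) = X + C 2 := by simp
    exact hq.associated_of_dvd (irreducible_X_sub_C _) (this ▸ h1)

end IsSymplecticPair

lemma aeval_X_sub_C_two_mul {P Q : Module.End K V} (ε : K) :
    aeval (P + Q) (X - C (2 * ε)) = P + Q - algebraMap K _ (2 * ε) := by
  rw [map_sub, aeval_X, aeval_C]

namespace IsSymplecticPair

variable {ω : LinearMap.BilinForm K V} {P Q : Module.End K V} (h : IsSymplecticPair ω P Q)
include h

/-- If `V` is annihilated by `q ^ (k + 1)` but not by `q ^ k`, where `q = X - 2 ε`, then the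
absence of odd blocks forces `(P - ε) q ^ k ≠ 0`: otherwise the largest block of `P` at `ε` would
have size `2 * k + 1`. -/
lemma exists_sub_apply_aeval_ne_zero (hP : NoOddBlocks P) {ε : K} (hε : ε ^ 2 = 1) {k : ℕ}
    (hk' : aeval (P + Q) ((X - C (2 * ε)) ^ k) ≠ 0) :
    ∃ v, (P - algebraMap K (Module.End K V) ε) (aeval (P + Q) ((X - C (2 * ε)) ^ k) v) ≠ 0 := by
  by_contra! hcon
  set N := P - algebraMap K (Module.End K V) ε with hN
  have hND : N * aeval (P + Q) ((X - C (2 * ε)) ^ k) = 0 := LinearMap.ext hcon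
  have hN2k : N ^ (2 * k) = aeval (P + Q) ((X - C (2 * ε)) ^ k) * P ^ k := by
    rw [pow_mul, hN, sub_algebraMap_sq h.mul_eq_one hε, ← aeval_X_sub_C_two_mul, map_pow,
      (h.commute_aeval_left _).eq, (h.commute_aeval_left _).symm.mul_pow]
  have hN0 : N ^ (2 * k + 1) = 0 := by
    rw [pow_succ', hN2k, ← mul_assoc, hND, zero_mul]
  have hN2k0 : N ^ (2 * k) = 0 := by
    refine LinearMap.ext fun v => ?_
    obtain ⟨y, hy⟩ := hP ε hε k ((N ^ (2 * k)) v)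
      (by rw [← hN, ← Module.End.mul_apply, ← pow_succ', hN0, LinearMap.zero_apply]) ⟨v, rfl⟩
    rw [← hy, ← hN, hN0]
    rfl
  apply hk'
  have hPQc : Commute P Q := by rw [Commute, SemiconjBy, h.mul_eq_one, h.mul_eq_one']
  have hPQk : P ^ k * Q ^ k = 1 := by rw [← hPQc.mul_pow, h.mul_eq_one, one_pow]
  rw [← mul_one (aeval (P + Q) ((X - C (2 * ε)) ^ k)), ← hPQk, ← mul_assoc, ← hN2k, hN2k0,
    zero_mul]

/-- In the alternating case, `P⁻¹ q ^ k v` is not in the cyclic `K[P + P⁻¹]`-module of `v`. An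
element of that module killed by `q` is a multiple `c u` of `u = q ^ k v`, and `P⁻¹ u = c u` gives
`c = ε` and `(P - ε) u = 0`. -/
lemma inv_apply_notMem_cyclicSpan {ε : K} (hε : ε ^ 2 = 1) {k : ℕ}
    (hk : aeval (P + Q) ((X - C (2 * ε)) ^ (k + 1)) = 0) {v : V}
    (hv : (P - algebraMap K (Module.End K V) ε) (aeval (P + Q) ((X - C (2 * ε)) ^ k) v) ≠ 0)
    (hD : P (aeval (P + Q) ((X - C (2 * ε)) ^ k) v) = Q (aeval (P + Q) ((X - C (2 * ε)) ^ k) v)) :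
    Q (aeval (P + Q) ((X - C (2 * ε)) ^ k) v) ∉ cyclicSpan (P + Q) v := by
  intro hmem
  obtain ⟨f, hf⟩ := mem_cyclicSpan.1 hmem
  set q : K[X] := X - C (2 * ε) with hq
  set u := aeval (P + Q) (q ^ k) v with hu
  have hu0 : u ≠ 0 := fun h0 => hv (by rw [h0, map_zero])
  have hqu : aeval (P + Q) q u = 0 := by
    rw [hu, ← Module.End.mul_apply, ← map_mul, ← pow_succ', hk, LinearMap.zero_apply]
  by_cases hd : q ^ (k + 1) ∣ q * f
  · rw [pow_succ', mul_dvd_mul_iff_left (X_sub_C_ne_zero _)] at hd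
    obtain ⟨g, rfl⟩ := hd
    set c := g.eval (2 * ε) with hc
    have hQu : Q u = c • u := by
      obtain ⟨s, hs⟩ := X_sub_C_dvd_sub_C_eval (a := 2 * ε) (p := g)
      rw [← hf, mul_comm, map_mul, Module.End.mul_apply, ← hu, eq_add_of_sub_eq hs, mul_comm,
        ← hq, map_add, map_mul, LinearMap.add_apply, Module.End.mul_apply, hqu, map_zero, zero_add,
        aeval_C, Module.algebraMap_end_apply]
    have hcc : c ^ 2 = 1 := by
      have h1 : c ^ 2 • u = (1 : K) • u := by
        rw [sq, mul_smul, ← hQu, ← map_smul, ← hQu, ← hD, h.left_inv, one_smul]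
      exact smul_left_injective K hu0 h1
    have h2c : 2 * c = 2 * ε := by
      refine smul_left_injective K hu0 ?_
      rw [hq, aeval_X_sub_C_two_mul, LinearMap.sub_apply, LinearMap.add_apply, hD, hQu,
        Module.algebraMap_end_apply, sub_eq_zero, ← two_smul K, smul_smul] at hqu
      exact hqu
    have hcε : c = ε := by
      rw [← sub_eq_zero]
      refine pow_eq_zero_iff two_ne_zero |>.1 ?_
      linear_combination hcc - ε * h2c - hε
    exact hv (by rw [LinearMap.sub_apply, Module.algebraMap_end_apply, hD, hQu, hcε, sub_self])
  · obtain ⟨a, b, hab⟩ := exists_mul_add_eq_pow_of_not_dvd (irreducible_X_sub_C _) hd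
    apply hu0
    rw [hu, hq, ← hab, map_add, map_mul _ _ b, hk, zero_mul, add_zero,
      show q * f * a = a * q * f by ring, map_mul, Module.End.mul_apply, hf, map_mul,
      Module.End.mul_apply, ← h.inv_apply_aeval, hqu, map_zero, map_zero]

/-- A primary `V` contains a nonzero isotropic subspace pairing perfectly with its image under
`P`. It is generated over `K[P + P⁻¹]` by one vector, except when the pairing
`ω x (P (q ^ k) y)` is alternating, where two vectors are needed. -/
lemma exists_pairing_of_primary [FiniteDimensional K V] (hP : NoOddBlocks P) {q : K[X]}
    (hqm : q.Monic) (hq : Irreducible q) {k : ℕ}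
    (hk : aeval (P + Q) (q ^ (k + 1)) = 0) (hk' : aeval (P + Q) (q ^ k) ≠ 0) :
    ∃ L : Submodule K V, L ≠ ⊥ ∧ (∀ x ∈ L, ∀ y ∈ L, ω x y = 0) ∧ (∀ x ∈ L, (P + Q) x ∈ L) ∧
      ∀ x ∈ L, (∀ y ∈ L, ω x (P y) = 0) → x = 0 := by
  have hiso : ∀ v, ∀ x ∈ cyclicSpan (P + Q) v, ∀ y ∈ cyclicSpan (P + Q) v, ω x y = 0 := by
    rintro v _ ⟨f, rfl⟩ _ ⟨g, rfl⟩
    change ω (aeval (P + Q) f v) (aeval (P + Q) g v) = 0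
    rw [h.aeval_adj, ← Module.End.mul_apply, ← map_mul, h.aeval_self]
  by_cases hD : ∀ v, ω v (P (aeval (P + Q) (q ^ k) v)) = 0
  · have hD' := h.apply_aeval_eq_of_alternating hD
    obtain ⟨ε, hε, rfl⟩ := h.exists_eq_X_sub_C_of_alternating hqm hq hk hk' hD'
    obtain ⟨v, hv⟩ := h.exists_sub_apply_aeval_ne_zero hP hε hk'
    have hz := h.inv_apply_notMem_cyclicSpan hε hk hv (hD' v)
    rw [← LinearMap.BilinForm.orthogonal_orthogonal h.nondeg h.alt.isRefl (cyclicSpan (P + Q) v),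
      LinearMap.BilinForm.mem_orthogonal_iff] at hz
    push Not at hz
    obtain ⟨w, hw, hwz⟩ := hz
    have hwv : ω w (P (aeval (P + Q) ((X - C (2 * ε)) ^ k) v)) ≠ 0 := by
      rw [hD']; exact hwz
    have hvw : ω v (P (aeval (P + Q) ((X - C (2 * ε)) ^ k) w)) ≠ 0 := by
      rwa [← h.adj', ← h.aeval_adj, ← h.inv_apply_aeval, h.swap, neg_ne_zero]
    have horth : ∀ x ∈ cyclicSpan (P + Q) v, ∀ y ∈ cyclicSpan (P + Q) w, ω x y = 0 := by
      rintro _ ⟨f, rfl⟩ _ ⟨g, rfl⟩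
      change ω (aeval (P + Q) f v) (aeval (P + Q) g w) = 0
      rw [← h.aeval_adj, ← Module.End.mul_apply, ← map_mul]
      exact hw _ ⟨_, rfl⟩
    refine ⟨cyclicSpan (P + Q) v ⊔ cyclicSpan (P + Q) w, ?_, ?_, ?_,
      h.pairing_cyclicSpan_sup hk (hD v) (hD w) hvw hwv⟩
    · intro hbot
      have h0 := (Submodule.eq_bot_iff _).1 hbot v
        (Submodule.mem_sup_left (self_mem_cyclicSpan _ _))
      exact hvw (by rw [h0, map_zero, LinearMap.zero_apply])
    · intro x hx y hy
      obtain ⟨x₁, hx₁, x₂, hx₂, rfl⟩ := Submodule.mem_sup.1 hx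
      obtain ⟨y₁, hy₁, y₂, hy₂, rfl⟩ := Submodule.mem_sup.1 hy
      simp only [map_add, LinearMap.add_apply]
      rw [hiso v x₁ hx₁ y₁ hy₁, hiso w x₂ hx₂ y₂ hy₂, horth x₁ hx₁ y₂ hy₂, h.swap x₂ y₁,
        horth y₁ hy₁ x₂ hx₂]
      simp
    · intro x hx
      obtain ⟨x₁, hx₁, x₂, hx₂, rfl⟩ := Submodule.mem_sup.1 hx
      rw [map_add]
      exact Submodule.add_mem_sup (map_mem_cyclicSpan hx₁) (map_mem_cyclicSpan hx₂)
  · push Not at hD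
    obtain ⟨v, hv⟩ := hD
    refine ⟨cyclicSpan (P + Q) v, ?_, hiso v, fun x hx => map_mem_cyclicSpan hx,
      h.pairing_cyclicSpan hq hk hv⟩
    intro hbot
    have h0 := (Submodule.eq_bot_iff _).1 hbot v (self_mem_cyclicSpan _ _)
    exact hv (by rw [h0, map_zero, LinearMap.zero_apply])

/-- Kernels of coprime polynomials in `P + P⁻¹` are orthogonal, so a primary component is
nondegenerate. -/
lemma disjoint_ker_orthogonal {a b : K[X]} (hab : IsCoprime a b)
    (hm : aeval (P + Q) (a * b) = 0) :
    Disjoint (LinearMap.ker (aeval (P + Q) a)) (ω.orthogonal (LinearMap.ker (aeval (P + Q) a))) := by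
  rw [Submodule.disjoint_def]
  intro x hx hx'
  rw [LinearMap.mem_ker] at hx
  refine h.eq_zero_of_forall fun y => ?_
  obtain ⟨s, t, hst⟩ := hab
  have hy : y = aeval (P + Q) (s * a) y + aeval (P + Q) (t * b) y := by
    rw [← LinearMap.add_apply, ← map_add, hst, map_one, Module.End.one_apply]
  have h1 : ω x (aeval (P + Q) (s * a) y) = 0 := by
    rw [← h.aeval_adj, map_mul, Module.End.mul_apply, hx, map_zero, map_zero,
      LinearMap.zero_apply]
  have h2 : ω x (aeval (P + Q) (t * b) y) = 0 := by
    rw [h.swap, neg_eq_zero]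
    refine hx' _ ?_
    rw [LinearMap.mem_ker, ← Module.End.mul_apply, ← map_mul, mul_left_comm, map_mul, hm, mul_zero,
      LinearMap.zero_apply]
  rw [hy, map_add, h1, h2, add_zero]

end IsSymplecticPair

/-- An isometry without odd blocks at `±1` has a split Lagrangian. -/
theorem IsSymplecticPair.exists_isSplitLagrangian {K : Type*} [Field K] (n : ℕ) :
    ∀ {V : Type*} [AddCommGroup V] [Module K V] [FiniteDimensional K V]
      {ω : LinearMap.BilinForm K V} {P Q : Module.End K V} (_ : IsSymplecticPair ω P Q)
      (_ : NoOddBlocks P) (_ : Module.finrank K V = n), ∃ L, IsSplitLagrangian ω P Q L ⊤ := by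
  induction n using Nat.strong_induction_on with
  | _ n ih =>
  intro V _ _ _ ω P Q h hP hn
  subst hn
  -- a split Lagrangian of a nondegenerate nonzero `U` is completed inside the complement of `U`
  have glue : ∀ (L U : Submodule K V), U ≠ ⊥ → IsSplitLagrangian ω P Q L U →
      (∀ x ∈ U, P x ∈ U) → (∀ x ∈ U, Q x ∈ U) → Disjoint U (ω.orthogonal U) →
      ∃ L, IsSplitLagrangian ω P Q L ⊤ := by
    intro L U hU hL hPU hQU hd
    have hc : IsCompl U (ω.orthogonal U) :=
      (LinearMap.BilinForm.isCompl_orthogonal_iff_disjoint h.alt.isRefl).2 hd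
    have hPW := h.orthogonal_stable hQU
    have hQW := h.orthogonal_stable' hPU
    have hd' : Disjoint (ω.orthogonal U) (ω.orthogonal (ω.orthogonal U)) := by
      rw [LinearMap.BilinForm.orthogonal_orthogonal h.nondeg h.alt.isRefl]
      exact hd.symm
    obtain ⟨L', hL'⟩ := ih _ (Submodule.finrank_lt fun htop => hU (by
        have := hc.disjoint
        rwa [htop, disjoint_top] at this))
      (h.restrict hPW hQW hd') (hP.restrict hPW hPU hc.symm) rfl
    have := hL.sup hL'.map_subtype hd (fun x hx y hy => hy x hx)
      (fun x hx y hy => by rw [h.swap, neg_eq_zero]; exact hy x hx)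
    rw [hc.sup_eq_top] at this
    exact ⟨_, this⟩
  rcases subsingleton_or_nontrivial V with hV | hV
  · exact ⟨⊤, fun x _ y _ => by rw [Subsingleton.elim x 0, map_zero, LinearMap.zero_apply],
      fun _ _ => Submodule.mem_top, fun _ _ _ _ _ => Subsingleton.elim _ _,
      fun u => ⟨fun _ => ⟨0, Submodule.mem_top, 0, Submodule.mem_top, Subsingleton.elim _ _⟩,
        fun _ => Submodule.mem_top⟩⟩
  have hint : IsIntegral K (P + Q) := Algebra.IsIntegral.isIntegral _
  have hm0 := minpoly.ne_zero hint
  obtain ⟨q, hqm, hq, hqd⟩ :=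
    Polynomial.exists_monic_irreducible_factor _ (minpoly.not_isUnit K (P + Q))
  obtain ⟨e, m, hqe, hme⟩ :=
    (WfDvdMonoid.max_power_factor hm0 hq)
  obtain ⟨k, rfl⟩ : ∃ k, e = k + 1 := by
    refine Nat.exists_eq_succ_of_ne_zero ?_
    rintro rfl
    rw [pow_zero, one_mul] at hme
    exact hqe (hme ▸ hqd)
  have hann : aeval (P + Q) (q ^ (k + 1) * m) = 0 := by rw [← hme, minpoly.aeval]
  by_cases htop : aeval (P + Q) (q ^ (k + 1)) = 0
  · have hk' : aeval (P + Q) (q ^ k) ≠ 0 := by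
      intro h0
      have := (Dvd.intro _ hme.symm).trans (minpoly.dvd K (P + Q) h0)
      have hu : q ∣ 1 := by
        rw [← mul_dvd_mul_iff_left (pow_ne_zero k hq.ne_zero), ← pow_succ, mul_one]
        exact this
      exact hq.not_isUnit (isUnit_of_dvd_one hu)
    obtain ⟨L, hL0, hiso, hst, hpair⟩ := h.exists_pairing_of_primary hP hqm hq htop hk'
    obtain ⟨U, hLU, hL, hPU, hQU, hd⟩ := h.isSplitLagrangian_of_pairing hiso hst hpair
    exact glue L U (fun h0 => hL0 (le_bot_iff.1 (h0 ▸ hLU))) hL hPU hQU hd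
  · set U := LinearMap.ker (aeval (P + Q) (q ^ (k + 1))) with hU
    have hPU : ∀ x ∈ U, P x ∈ U := fun x hx => by
      rw [hU, LinearMap.mem_ker, ← h.apply_aeval, LinearMap.mem_ker.1 hx, map_zero]
    have hQU : ∀ x ∈ U, Q x ∈ U := fun x hx => by
      rw [hU, LinearMap.mem_ker, ← h.inv_apply_aeval, LinearMap.mem_ker.1 hx, map_zero]
    have hcop : IsCoprime (q ^ (k + 1)) m := (hq.coprime_iff_not_dvd.2 hqe).pow_left
    have hd := h.disjoint_ker_orthogonal hcop hann
    have hc : IsCompl U (ω.orthogonal U) :=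
      (LinearMap.BilinForm.isCompl_orthogonal_iff_disjoint h.alt.isRefl).2 hd
    obtain ⟨L, hL⟩ := ih _ (Submodule.finrank_lt fun h0 => htop (LinearMap.ker_eq_top.1 h0))
      (h.restrict hPU hQU hd) (hP.restrict hPU (h.orthogonal_stable hQU) hc) rfl
    refine glue _ U ?_ hL.map_subtype hPU hQU hd
    intro hbot
    have hm : aeval (P + Q) m = 0 := by
      refine LinearMap.ext fun x => LinearMap.ker_eq_bot.1 hbot ?_
      rw [← Module.End.mul_apply, ← map_mul, hann, LinearMap.zero_apply]
      exact (map_zero _).symm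
    have hdm := minpoly.dvd K (P + Q) hm
    exact hqe (hqd.trans hdm)

end Symplectic

/-! ### Symplectic matrices -/

lemma NoOddBlocks.of_semiconj {K V W : Type*} [Field K] [AddCommGroup V] [Module K V]
    [AddCommGroup W] [Module K W] {P : Module.End K V} {P' : Module.End K W} (e : V ≃ₗ[K] W)
    (he : ∀ x, e (P x) = P' (e x)) (h : NoOddBlocks P') : NoOddBlocks P := by
  intro ε hε t x hx hy
  obtain ⟨y, rfl⟩ := hy
  have h1 : ∀ x, e ((P - algebraMap K _ ε) x) = (P' - algebraMap K _ ε) (e x) := fun x => by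
    simp [he]
  have hpow : ∀ (n : ℕ) (x : V),
      e (((P - algebraMap K _ ε) ^ n) x) = ((P' - algebraMap K _ ε) ^ n) (e x) := by
    intro n
    induction n with
    | zero => intro x; rfl
    | succ n ih => intro x; rw [pow_succ, pow_succ, Module.End.mul_apply, ih, h1]; rfl
  obtain ⟨z, hz⟩ := h ε hε t _ (by rw [← h1, hx, map_zero]) ⟨e y, (hpow _ y).symm⟩
  refine ⟨e.symm z, e.injective ?_⟩
  rw [hpow, e.apply_symm_apply, hz]

lemma noOddBlocks_toLin'_iff {K : Type*} [Field K] {m : Type*} [Fintype m] [DecidableEq m]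
    (A : Matrix m m K) :
    NoOddBlocks (Matrix.toLin' A) ↔ ¬ ∃ t : ℕ, IsElementaryDivisor A ((X - 1) ^ (2 * t + 1)) ∨
      IsElementaryDivisor A ((X + 1) ^ (2 * t + 1)) := by
  have e1 : (X - 1 : K[X]) = X - C 1 := by simp
  have e2 : (X + 1 : K[X]) = X - C (-1) := by simp
  simp only [e1, e2, isElementaryDivisor_X_sub_C_pow_iff]
  constructor
  · rintro h ⟨t, ⟨x, h1, h2, h3⟩ | ⟨x, h1, h2, h3⟩⟩
    · exact h3 (h 1 (by simp) t x h1 h2)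
    · exact h3 (h (-1) (by simp) t x h1 h2)
  · intro h ε hε t x h1 h2
    by_contra h3
    rcases mul_self_eq_one_iff.1 ((sq ε).symm.trans hε) with rfl | rfl
    · exact h ⟨t, Or.inl ⟨x, h1, h2, h3⟩⟩
    · exact h ⟨t, Or.inr ⟨x, h1, h2, h3⟩⟩

namespace Matrix

variable {K l : Type*} [Field K] [Fintype l] [DecidableEq l]

/-- A symplectic matrix acts as an isometry of the standard alternating form. -/
lemma isSymplecticPair_toLin' {A : Matrix (l ⊕ l) (l ⊕ l) K} (hA : A ∈ symplecticGroup l K) :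
    IsSymplecticPair (toBilin' (J l K)) (toLin' A) (toLin' A⁻¹) := by
  have hu := SymplecticGroup.symplectic_det hA
  have hAJ : Aᵀ * J l K = J l K * A⁻¹ := by
    nth_rw 2 [← SymplecticGroup.mem_iff'.1 hA]
    rw [mul_assoc, mul_nonsing_inv _ hu, mul_one]
  refine ⟨?_, ?_, ?_, ?_, ?_⟩
  · intro x
    rw [toBilin'_apply', J, fromBlocks_mulVec]
    simp only [zero_mulVec, zero_add, neg_mulVec, one_mulVec, add_zero]
    rw [dotProduct, Fintype.sum_sum_type, ← Finset.sum_add_distrib]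
    refine Finset.sum_eq_zero fun i _ => ?_
    simp
    ring
  · exact LinearMap.BilinForm.nondegenerate_toBilin'_of_det_ne_zero' _ (isUnit_det_J l K).ne_zero
  · intro x
    rw [toLin'_apply, toLin'_apply, mulVec_mulVec, mul_nonsing_inv _ hu, one_mulVec]
  · intro x
    rw [toLin'_apply, toLin'_apply, mulVec_mulVec, nonsing_inv_mul _ hu, one_mulVec]
  · intro x y
    rw [toBilin'_apply', toBilin'_apply', toLin'_apply, toLin'_apply, mulVec_mulVec, ← hAJ,
      ← mulVec_mulVec, dotProduct_mulVec x, vecMul_transpose]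

/-- In the block form, the space is the direct sum of the first coordinate subspace, which is stable
under the sum of the matrix and its inverse, and of its image. -/
lemma noOddBlocks_fromBlocks {B D : Matrix l l K} (hB : IsUnit B) (hBs : B.IsSymm)
    (h : fromBlocks 0 B (-B⁻¹) D ∈ symplecticGroup l K) :
    NoOddBlocks (toLin' (fromBlocks 0 B (-B⁻¹) D)) := by
  have hBd : IsUnit B.det := (isUnit_iff_isUnit_det _).1 hB
  obtain ⟨-, h2, -⟩ := SymplecticGroup.fromBlocks_mem_iff.1 h
  rw [hBs.eq] at h2
  have hDB : D * B⁻¹ = B⁻¹ * Dᵀ := by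
    nth_rw 1 [← nonsing_inv_mul_cancel_left _ D hBd]
    rw [h2, mul_assoc, mul_assoc, mul_nonsing_inv _ hBd, mul_one]
  have hinv : fromBlocks 0 B (-B⁻¹) D * fromBlocks Dᵀ (-B) B⁻¹ 0 = 1 := by
    rw [fromBlocks_multiply, ← fromBlocks_one]
    simp [mul_nonsing_inv _ hBd, nonsing_inv_mul _ hBd, hDB]
  let L : Submodule K (l ⊕ l → K) := LinearMap.ker (LinearMap.funLeft K K Sum.inr)
  have hL : ∀ x, x ∈ L ↔ ∃ y, Sum.elim y (0 : l → K) = x := by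
    intro x
    constructor
    · intro hx
      refine ⟨x ∘ Sum.inl, ?_⟩
      have : x ∘ Sum.inr = 0 := hx
      rw [← this, Sum.elim_comp_inl_inr]
    · rintro ⟨y, rfl⟩
      rfl
  refine noOddBlocks_of_isCompl (Q := toLin' (fromBlocks Dᵀ (-B) B⁻¹ 0)) (L := L) ?_ ?_ ?_ ?_
  · rw [Module.End.mul_eq_comp, ← toLin'_mul, hinv, toLin'_one]
    rfl
  · rw [Module.End.mul_eq_comp, ← toLin'_mul, mul_eq_one_comm.1 hinv, toLin'_one]
    rfl
  · intro x hx
    obtain ⟨y, rfl⟩ := (hL x).1 hx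
    refine (hL _).2 ⟨Dᵀ *ᵥ y, ?_⟩
    rw [LinearMap.add_apply, toLin'_apply, toLin'_apply, fromBlocks_mulVec, fromBlocks_mulVec,
      ← Sum.elim_add_add]
    simp [neg_mulVec]
  · constructor
    · rw [Submodule.disjoint_def]
      rintro x hx ⟨z, hz, rfl⟩
      obtain ⟨y, rfl⟩ := (hL z).1 hz
      obtain ⟨y', hy'⟩ := (hL _).1 hx
      rw [toLin'_apply, fromBlocks_mulVec] at hy' ⊢
      simp only [Sum.elim_comp_inl, Sum.elim_comp_inr, zero_mulVec, zero_add] at hy' ⊢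
      have h0 := congrArg (· ∘ Sum.inr) hy'
      rw [Sum.elim_comp_inr, Sum.elim_comp_inr] at h0
      rw [← h0]
      exact funext fun i => by cases i <;> simp
    · rw [codisjoint_iff, eq_top_iff]
      intro x _
      have hx : x = Sum.elim (x ∘ Sum.inl) 0 +
          toLin' (fromBlocks 0 B (-B⁻¹) D) (Sum.elim (-(B *ᵥ (x ∘ Sum.inr))) 0) := by
        have h1 : (-B⁻¹) *ᵥ -(B *ᵥ (x ∘ Sum.inr)) = x ∘ Sum.inr := by
          rw [neg_mulVec_neg, mulVec_mulVec, nonsing_inv_mul _ hBd, one_mulVec]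
        rw [toLin'_apply, fromBlocks_mulVec, Sum.elim_comp_inl, Sum.elim_comp_inr, h1,
          ← Sum.elim_add_add]
        simp
      rw [hx]
      exact Submodule.add_mem_sup ((hL _).2 ⟨_, rfl⟩) ⟨_, (hL _).2 ⟨_, rfl⟩, rfl⟩

/-- A frame `E` of a split Lagrangian and the frame of `P L` dual to it form a symplectic basis in
which `P` has the block form. -/
lemma exists_semiconj_fromBlocks {A : Matrix (l ⊕ l) (l ⊕ l) K} (hA : A ∈ symplecticGroup l K)
    {E : Matrix (l ⊕ l) l K} {C : Matrix l l K} (hE : Eᵀ * J l K * E = 0)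
    (hC : A * E + A⁻¹ * E = E * C) (hM : IsUnit (Eᵀ * J l K * (A * E))) :
    ∃ B D : Matrix l l K, ∃ T ∈ symplecticGroup l K, B.IsSymm ∧ IsUnit B ∧
      A * T = T * fromBlocks 0 B (-B⁻¹) D := by
  have hu := SymplecticGroup.symplectic_det hA
  have hAJA := SymplecticGroup.mem_iff'.1 hA
  have hAJ : Aᵀ * J l K = J l K * A⁻¹ := by
    nth_rw 2 [← hAJA]
    rw [mul_assoc, mul_nonsing_inv _ hu, mul_one]
  set M := Eᵀ * J l K * (A * E) with hMdef
  have hMd : IsUnit M.det := (isUnit_iff_isUnit_det _).1 hM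
  have hM' : Eᵀ * Aᵀ * J l K * E = -M := by
    have h1 : Eᵀ * J l K * (A * E + A⁻¹ * E) = 0 := by rw [hC, ← Matrix.mul_assoc, hE, zero_mul]
    rw [Matrix.mul_add, ← hMdef] at h1
    rw [Matrix.mul_assoc Eᵀ, hAJ, ← Matrix.mul_assoc, Matrix.mul_assoc _ A⁻¹]
    exact eq_neg_of_add_eq_zero_right h1
  have hMs : Mᵀ = M := by
    rw [hMdef, transpose_mul, transpose_mul, transpose_mul, transpose_transpose, J_transpose,
      Matrix.neg_mul, Matrix.mul_neg, ← Matrix.mul_assoc, hM', neg_neg]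
  have hMi : (M⁻¹)ᵀ = M⁻¹ := by rw [transpose_nonsing_inv, hMs]
  refine ⟨M⁻¹, M * C * M⁻¹, fromCols E (-(A * E * M⁻¹)), ?_, hMi, ?_, ?_⟩
  · rw [SymplecticGroup.mem_iff', transpose_fromCols, fromRows_mul, fromRows_mul_fromCols, hE]
    have h12 : Eᵀ * J l K * -(A * E * M⁻¹) = -1 := by
      rw [Matrix.mul_neg, ← Matrix.mul_assoc, ← hMdef, mul_nonsing_inv _ hMd]
    have h21 : (-(A * E * M⁻¹))ᵀ * J l K * E = 1 := by
      rw [transpose_neg, transpose_mul, transpose_mul, hMi, Matrix.neg_mul, Matrix.neg_mul,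
        Matrix.mul_assoc, Matrix.mul_assoc, ← Matrix.mul_assoc _ (J l K), hM', Matrix.mul_neg,
        neg_neg, nonsing_inv_mul _ hMd]
    have h22 : (-(A * E * M⁻¹))ᵀ * J l K * -(A * E * M⁻¹) = 0 := by
      have h0 : Eᵀ * Aᵀ * J l K * (A * E) = 0 := by
        rw [← hE]
        nth_rw 2 [← hAJA]
        simp only [Matrix.mul_assoc]
      rw [transpose_neg, transpose_mul, transpose_mul, hMi, Matrix.neg_mul, Matrix.neg_mul,
        Matrix.mul_neg, neg_neg, Matrix.mul_assoc, Matrix.mul_assoc, ← Matrix.mul_assoc _ (J l K),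
        ← Matrix.mul_assoc _ (A * E), h0, Matrix.zero_mul, Matrix.mul_zero]
    rw [h12, h21, h22, J]
  · exact (isUnit_nonsing_inv_iff).2 hM
  · have hAA : A * (A * E) = A * E * C - E := by
      rw [Matrix.mul_assoc, ← hC, Matrix.mul_add, ← Matrix.mul_assoc A A⁻¹, mul_nonsing_inv _ hu,
        Matrix.one_mul, add_sub_cancel_right]
    rw [mul_fromCols, fromCols_mul_fromBlocks, nonsing_inv_nonsing_inv _ hMd]
    congr 1
    · rw [Matrix.mul_zero, zero_add, Matrix.neg_mul, Matrix.mul_neg, neg_neg,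
        nonsing_inv_mul_cancel_right _ _ hMd]
    · rw [Matrix.mul_neg, ← Matrix.mul_assoc, hAA, Matrix.neg_mul, Matrix.mul_assoc (A * E),
        ← Matrix.mul_assoc M⁻¹, ← Matrix.mul_assoc M⁻¹, nonsing_inv_mul _ hMd, Matrix.one_mul,
        Matrix.sub_mul, Matrix.mul_assoc (A * E)]
      abel

/-- The columns of `E` form a basis of the split Lagrangian, `C` is the matrix of `A + A⁻¹` in this
basis, and the last matrix is that of the pairing between `L` and `A L`. -/
lemma exists_frame_of_isSplitLagrangian {A : Matrix (l ⊕ l) (l ⊕ l) K}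
    (hA : A ∈ symplecticGroup l K) {L : Submodule K (l ⊕ l → K)}
    (hL : IsSplitLagrangian (toBilin' (J l K)) (toLin' A) (toLin' A⁻¹) L ⊤) :
    ∃ (E : Matrix (l ⊕ l) l K) (C : Matrix l l K), Eᵀ * J l K * E = 0 ∧
      A * E + A⁻¹ * E = E * C ∧ IsUnit (Eᵀ * J l K * (A * E)) := by
  have hs := isSymplecticPair_toLin' hA
  have hinj : Function.Injective (toLin' A) :=
    Function.LeftInverse.injective (g := toLin' A⁻¹) hs.left_inv
  have hcompl : IsCompl L (L.map (toLin' A)) := by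
    constructor
    · rw [Submodule.disjoint_def]
      rintro _ hx ⟨y, hy, rfl⟩
      exact hL.disjoint _ hx y hy rfl
    · rw [codisjoint_iff, eq_top_iff]
      intro u hu
      obtain ⟨x, hx, y, hy, rfl⟩ := (hL.mem_iff u).1 hu
      exact Submodule.add_mem_sup hx ⟨y, hy, rfl⟩
  have hdim : Module.finrank K L = Fintype.card l := by
    have h1 := Submodule.finrank_add_eq_of_isCompl hcompl
    have h2 : Module.finrank K (L.map (toLin' A)) = Module.finrank K L :=
      (Submodule.equivMapOfInjective _ hinj L).finrank_eq.symm
    rw [h2, Module.finrank_fintype_fun_eq_card, Fintype.card_sum] at h1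
    omega
  let e : (l → K) ≃ₗ[K] L := LinearEquiv.ofFinrankEq _ _ (by
    rw [hdim, Module.finrank_fintype_fun_eq_card])
  let E : Matrix (l ⊕ l) l K := LinearMap.toMatrix' (L.subtype ∘ₗ e.toLinearMap)
  have hEv : ∀ y, E *ᵥ y = e y := fun y => LinearMap.toMatrix'_mulVec _ _
  have hEmem : ∀ y, E *ᵥ y ∈ L := fun y => by rw [hEv]; exact Subtype.property _
  have hEL : ∀ x ∈ L, ∃ y, E *ᵥ y = x := fun x hx =>
    ⟨e.symm ⟨x, hx⟩, by rw [hEv, e.apply_symm_apply]⟩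
  have hform : ∀ (F : Matrix (l ⊕ l) l K) (y z : l → K),
      y ⬝ᵥ ((Eᵀ * J l K * F) *ᵥ z) = toBilin' (J l K) (E *ᵥ y) (F *ᵥ z) := by
    intro F y z
    rw [toBilin'_apply', mulVec_mulVec, Matrix.mul_assoc, ← mulVec_mulVec, dotProduct_mulVec,
      vecMul_transpose]
  have hcol : ∀ j, ∃ c, E *ᵥ c = (A * E + A⁻¹ * E) *ᵥ Pi.single j 1 := by
    intro j
    have := hEL _ (hL.stable _ (hEmem (Pi.single j 1)))
    rwa [LinearMap.add_apply, toLin'_apply, toLin'_apply, mulVec_mulVec, mulVec_mulVec,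
      ← add_mulVec] at this
  choose c hc using hcol
  refine ⟨E, of fun i j => c j i, ?_, ?_, ?_⟩
  · refine ext_of_mulVec_single fun j => ?_
    rw [zero_mulVec]
    refine dotProduct_eq_zero _ fun y => ?_
    rw [dotProduct_comm, hform]
    exact hL.isotropic _ (hEmem _) _ (hEmem _)
  · refine ext_of_mulVec_single fun j => ?_
    rw [← hc, ← mulVec_mulVec]
    congr 1
    rw [mulVec_single_one]
    rfl
  · rw [← mulVec_injective_iff_isUnit]
    refine (injective_iff_map_eq_zero (mulVecLin (Eᵀ * J l K * (A * E)))).2 fun z hz => ?_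
    have hz' : (Eᵀ * J l K * (A * E)) *ᵥ z = 0 := hz
    -- the vector `A E z` is orthogonal to `L` and to `A L`, hence to everything
    have hAz : toLin' A (E *ᵥ z) = 0 := by
      refine hs.eq_zero_of_forall fun u => ?_
      obtain ⟨x, hx, y, hy, rfl⟩ := (hL.mem_iff u).1 Submodule.mem_top
      obtain ⟨x', rfl⟩ := hEL x hx
      have h1 := hform (A * E) x' z
      rw [hz', dotProduct_zero, ← mulVec_mulVec] at h1
      rw [map_add, hs.swap, toLin'_apply, ← h1, ← toLin'_apply, hs.adj, hs.left_inv,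
        hL.isotropic _ (hEmem z) _ hy, neg_zero, add_zero]
    have hEz : E *ᵥ z = 0 := hinj (by rw [hAz, map_zero])
    rw [hEv] at hEz
    exact e.map_eq_zero_iff.1 (Subtype.ext hEz)

end Matrix

theorem mainTheorem4 {K : Type*} [Field K] (n : ℕ) (P : Matrix.symplecticGroup (Fin n) K) :
    (∃ (B D : Matrix (Fin n) (Fin n) K) (P₁ : Matrix.symplecticGroup (Fin n) K),
        B.IsSymm ∧ IsUnit B ∧
        (P₁ : Matrix (Fin n ⊕ Fin n) (Fin n ⊕ Fin n) K) = Matrix.fromBlocks 0 B (-B⁻¹) D ∧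
        IsConj P P₁) ↔
      ¬ ∃ t : ℕ,
        IsElementaryDivisor (P : Matrix (Fin n ⊕ Fin n) (Fin n ⊕ Fin n) K)
            ((X - 1) ^ (2 * t + 1)) ∨
        IsElementaryDivisor (P : Matrix (Fin n ⊕ Fin n) (Fin n ⊕ Fin n) K)
            ((X + 1) ^ (2 * t + 1)) := by
  rw [← noOddBlocks_toLin'_iff]
  constructor
  · rintro ⟨B, D, P₁, hBs, hB, hP₁, hconj⟩
    obtain ⟨c, hc⟩ := isConj_iff.1 hconj
    have hcP : (c : Matrix (Fin n ⊕ Fin n) (Fin n ⊕ Fin n) K) * P = P₁ * c := by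
      rw [← Submonoid.coe_mul, ← Submonoid.coe_mul, ← hc, inv_mul_cancel_right]
    have hcu := SymplecticGroup.symplectic_det c.2
    refine NoOddBlocks.of_semiconj (Matrix.toLinearEquiv'
      (c : Matrix (Fin n ⊕ Fin n) (Fin n ⊕ Fin n) K)
      ((Matrix.isUnit_iff_isUnit_det _).2 hcu).invertible) (P' := Matrix.toLin' P₁) ?_ ?_
    · intro x
      change Matrix.toLin' (c : Matrix (Fin n ⊕ Fin n) (Fin n ⊕ Fin n) K) (Matrix.toLin' P x) =
        Matrix.toLin' P₁ (Matrix.toLin' (c : Matrix (Fin n ⊕ Fin n) (Fin n ⊕ Fin n) K) x)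
      rw [← LinearMap.comp_apply, ← LinearMap.comp_apply, ← Matrix.toLin'_mul, ← Matrix.toLin'_mul,
        hcP]
    · rw [hP₁]
      exact Matrix.noOddBlocks_fromBlocks hB hBs (hP₁ ▸ P₁.2)
  · intro h
    obtain ⟨L, hL⟩ := (Matrix.isSymplecticPair_toLin' P.2).exists_isSplitLagrangian _ h rfl
    obtain ⟨E, C, hE, hC, hM⟩ := Matrix.exists_frame_of_isSplitLagrangian P.2 hL
    obtain ⟨B, D, T, hT, hBs, hB, hPT⟩ := Matrix.exists_semiconj_fromBlocks P.2 hE hC hM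
    have key : ((⟨T, hT⟩⁻¹ * P * ⟨T, hT⟩ : Matrix.symplecticGroup (Fin n) K) :
        Matrix (Fin n ⊕ Fin n) (Fin n ⊕ Fin n) K) = Matrix.fromBlocks 0 B (-B⁻¹) D := by
      rw [mul_assoc, Submonoid.coe_mul, Submonoid.coe_mul, hPT, SymplecticGroup.coe_inv',
        Matrix.nonsing_inv_mul_cancel_left _ _ (SymplecticGroup.symplectic_det hT)]
    refine ⟨B, D, _, hBs, hB, key, isConj_iff.2 ⟨⟨T, hT⟩⁻¹, by rw [inv_inv]⟩⟩
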